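/- **Setting.** Let $\Theta\subseteq\mathbb R^n$, $B\subseteq\mathbb R^m$ be parameter sets (for instance the whole spaces) and let $\theta_o$ be an interior point of $\Theta$. For $\theta\in\Theta$ consider the stochastic Wiener system $$z(t)=G(q,\theta)u(t)+v(t),\qquad y(t)=f(z(t))+e(t),$$ where $G(q,\theta)u(t)=\sum_{k\ge0}g_k(\theta)u(t-k)$ with $\sum_k|g_k(\theta)|<\infty$, the function $f$ is known and measurable, $\{v(t)\}$ and $\{e(t)\}$ are mutually independent zero-mean Gaussian white noises with variances $\sigma_v^2,\sigma_e^2$, and $\{u(t)\}$ is a strictly stationary input process with finite second moment that is independent of $(v,e)$; $f(z(t))$ is assumed square integrable for every $\theta\in\Theta$. Let $G_{lin}(q,\beta)$, $\beta\in B$, be a family of stable linear transfer functions (absolutely summable impulse responses), and put $$Q(\beta,\theta)=\mathrm E\{[y(t)-G_{lin}(q,\beta)u(t)]^2\}\quad(y \text{ generated with parameter }\theta),\qquad \beta(\theta)\in\arg\min_{\beta\in B}Q(\beta,\theta),\qquad \beta_o=\beta(\theta_o).$$ **Step 1.** With data generated by the system with $\theta=\theta_o$, let $\hat\beta_N$ be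 a (measurable) estimate which for all large $N$ satisfies, almost surely, $$\hat\beta_N\in\arg\min_{\beta\in B}\frac1N\sum_{t=1}^N[y(t)-G_{lin}(q,\beta)u(t)]^2 .$$ **Step 2.** Let $\hat\theta_N$ be a (measurable) estimate which for all large $N$ satisfies, almost surely, $$\hat\theta_N\in\arg\min_{\theta\in\Theta}\,[\beta(\theta)-\hat\beta_N]^TW[\beta(\theta)-\hat\beta_N].$$ **Assumptions.** 1. The limit $\lim_{N\to\infty}\mathrm{Cov}\{\sqrt N(\hat\beta_N-\beta_o)\}$ exists and is invertible, and $W=[\lim_{N\to\infty}\mathrm{Cov}\{\sqrt N(\hat\beta_N-\beta_o)\}]^{-1}$. 2. $\beta(\cdot)$ is differentiable at $\theta_o$ with Jacobian $G=\frac{\partial\beta}{\partial\theta}(\theta_o)\in\mathbb R^{m\times n}$, and $G^TWG$ is invertible. 3. $\beta(\cdot)$ has a left inverse $\alpha$, that is, $\alpha(\beta(\theta))=\theta$ for all $\theta\in\Theta$, which on $\beta(\Theta)$ is continuous at $\beta_o$ and of at most polynomial growth: there are an integer $p\ge1$ and a constant $C$ with $\|\alpha(b)\|\le C(1+\|b\|^p)$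 for all $b\in\beta(\Theta)$ (if $\Theta$ is bounded, the growth condition holds with $p=1$). 4. From some $N$ on, the families $N\|\hat\beta_N-\beta_o\|^{2}$ and $N\|\hat\beta_N-\beta_o\|^{2p}$ are uniformly integrable. **Conclusion (variance expression).** For all large $N$ the vector $\sqrt N(\hat\theta_N-\theta_o)$ is square integrable, and $$\lim_{N\to\infty}\mathrm{Cov}\{\sqrt N(\hat\theta_N-\theta_o)\}=[G^TWG]^{-1}.$$ -/

import Mathlib

open MeasureTheory ProbabilityTheory Filter Topology
open scoped NNReal ENNReal Matrix

noncomputable section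

namespace IndirectInference

/-- The output `G(q) u(t) = ∑_{k ≥ 0} g_k u(t - k)` at time `t` of the causal linear filter with
impulse response `g`, driven by the two-sided signal `u`. -/
def filterOut (g : ℕ → ℝ) (u : ℤ → ℝ) (t : ℤ) : ℝ := ∑' k : ℕ, g k * u (t - k)

/-- BIBO stability of the transfer function with impulse response `g`. -/
def StableFilter (g : ℕ → ℝ) : Prop := Summable fun k => |g k|

/-- The output `y(t) = f (G(q) u(t) + v(t)) + e(t)` of a Wiener system, where `g` is the impulse
response of `G(q)`. -/
def wienerOutput (f : ℝ → ℝ) (g : ℕ → ℝ) (u v e : ℤ → ℝ) (t : ℤ) : ℝ :=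
  f (filterOut g u t + v t) + e t

section Model

variable {Ω : Type*} [MeasurableSpace Ω]

/-- `w` is zero-mean Gaussian white noise with variance `σ2`. -/
structure IsGaussianWhiteNoise (P : Measure Ω) (w : ℤ → Ω → ℝ) (σ2 : ℝ≥0) : Prop where
  measurable : ∀ t, Measurable (w t)
  gaussian : ∀ t, P.map (w t) = gaussianReal 0 σ2
  indep : iIndepFun w P

/-- `u` is a strictly stationary process with finite second moment. -/
structure IsStationaryInput (P : Measure Ω) (u : ℤ → Ω → ℝ) : Prop where
  measurable : ∀ t, Measurable (u t)
  stationary : ∀ s : ℤ, P.map (fun ω t => u (t + s) ω) = P.map (fun ω t => u t ω)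
  memLp : MemLp (u 0) 2 P

/-- The stochastic Wiener model class `z(t) = G(q,θ) u(t) + v(t)`, `y(t) = f(z(t)) + e(t)`,
`θ ∈ Θ`: `g θ` is the impulse response of the stable transfer function `G(q,θ)`, the input `u` is
stationary and independent of the noises (open loop), and the process noise `v` and the
measurement noise `e` are mutually independent Gaussian white noises. The outputs have finite
second moment. -/
structure IsStochasticWienerModel {n : ℕ} (P : Measure Ω) (Θ : Set (Fin n → ℝ))
    (g : (Fin n → ℝ) → ℕ → ℝ) (f : ℝ → ℝ) (u v e : ℤ → Ω → ℝ) (σv2 σe2 : ℝ≥0) : Prop where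
  input : IsStationaryInput P u
  processNoise : IsGaussianWhiteNoise P v σv2
  measurementNoise : IsGaussianWhiteNoise P e σe2
  indep_noises : IndepFun (fun ω t => v t ω) (fun ω t => e t ω) P
  open_loop : IndepFun (fun ω t => u t ω) (fun ω => (fun t => v t ω, fun t => e t ω)) P
  measurable_f : Measurable f
  stable : ∀ θ ∈ Θ, StableFilter (g θ)
  memLp_output : ∀ θ ∈ Θ, ∀ t,
    MemLp (fun ω => f (filterOut (g θ) (fun s => u s ω) t + v t ω)) 2 P

/-- The empirical cost `Q_N(b) = (1/N) ∑_{t=1}^N [y(t) - G_lin(q,b) u(t)]²`, where `h b` is the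
impulse response of `G_lin(q,b)`. -/
def empiricalCost {m : ℕ} (h : (Fin m → ℝ) → ℕ → ℝ) (u y : ℤ → ℝ) (N : ℕ)
    (b : Fin m → ℝ) : ℝ :=
  (1 / (N : ℝ)) * ∑ t ∈ Finset.Icc 1 N, (y (t : ℤ) - filterOut (h b) u (t : ℤ)) ^ 2

/-- The limit cost `Q(b,θ) = E [y(t) - G_lin(q,b) u(t)]²` when the data are generated by the Wiener
system with parameter `θ`; by stationarity it does not depend on `t`, and is written for
`t = 0`. -/
def limitCost {n m : ℕ} (P : Measure Ω) (g : (Fin n → ℝ) → ℕ → ℝ)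
    (h : (Fin m → ℝ) → ℕ → ℝ) (f : ℝ → ℝ) (u v e : ℤ → Ω → ℝ)
    (b : Fin m → ℝ) (θ : Fin n → ℝ) : ℝ :=
  ∫ ω, (wienerOutput f (g θ) (fun s => u s ω) (fun s => v s ω) (fun s => e s ω) 0
    - filterOut (h b) (fun s => u s ω) 0) ^ 2 ∂P

/-- The covariance matrix of a random vector. -/
def covMatrix {ι : Type*} (P : Measure Ω) (X : Ω → ι → ℝ) : Matrix ι ι ℝ :=
  Matrix.of fun i j => cov[fun ω => X ω i, fun ω => X ω j; P]

end Model

/-- `x` is a minimizer of `F` over `S`. -/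
def IsArgmin {E : Type*} (F : E → ℝ) (S : Set E) (x : E) : Prop := x ∈ S ∧ IsMinOn F S x

/-- The Step-2 cost `[β(θ) - b]ᵀ W [β(θ) - b]`. -/
def stepTwoCost {n m : ℕ} (β : (Fin n → ℝ) → (Fin m → ℝ)) (W : Matrix (Fin m) (Fin m) ℝ)
    (b : Fin m → ℝ) (θ : Fin n → ℝ) : ℝ :=
  (β θ - b) ⬝ᵥ (W *ᵥ (β θ - b))

/-- The Jacobian matrix `∂β/∂θ (θ) ∈ ℝ^{m × n}`. -/
def jacobian {n m : ℕ} (β : (Fin n → ℝ) → (Fin m → ℝ)) (θ : Fin n → ℝ) :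
    Matrix (Fin m) (Fin n) ℝ :=
  LinearMap.toMatrix' (fderiv ℝ β θ : (Fin n → ℝ) →ₗ[ℝ] (Fin m → ℝ))

end IndirectInference

end

/-!
Write `H = Gᵀ W G` and let `T = H⁻¹ Gᵀ W` send `x` to the coefficients of its `W`-orthogonal
projection onto the range of `G`. The proof is a delta method in `L²`:

`√N (θhat - θo) = T (√N (βhat - βo)) + √N R_N`, with `√N R_N → 0` in `L²`.

Hence the covariance has the same limit as `T Cov(√N (βhat - βo)) Tᵀ`, namely
`T W⁻¹ Tᵀ = H⁻¹` (`tendsto_covMatrix_add`, `covMatrix_mulVec`,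
`projection_mul_inv_mul_transpose`).

The remainder is controlled by two deterministic facts about a minimizer `θ` of the `W`-distance
from `β θ` to `b`. Since `θo` is a competitor, `‖β θ - βo‖` is at most a constant times
`‖b - βo‖`.

* Near `βo`, the left inverse is continuous and `G` is injective, so
  `‖θ - θo‖ = O(‖b - βo‖)`. The point `θo + T (b - βo)` is a competitor because `θo` is interior,
  and Pythagoras' theorem in the `W`-norm gives `θ - θo - T (b - βo) = o(‖b - βo‖)`
  (`exists_argmin_sub_linear_le`). Only differentiability of `β` at the single point `θo` is needed:
  no first-order condition for `θ` is used.
* Everywhere, the growth of the left inverse gives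
  `‖θ - θo‖ = O(‖b - βo‖ + ‖b - βo‖ ^ p)` (`exists_global_norm_sub_le`).

The first bound handles the event where `βhat` is close to `βo`. The complementary event has
probability tending to zero, so there uniform integrability and the second bound suffice
(`tendsto_eLpNorm_smul_of_remainder`).
-/

namespace IndirectInference

/-! ### Deterministic perturbation bounds for minimum-distance estimates -/

section Deterministic

variable {V F H : Type*} [NormedAddCommGroup V] [NormedSpace ℝ V]
  [NormedAddCommGroup F] [NormedSpace ℝ F] [NormedAddCommGroup H] [InnerProductSpace ℝ H]

/-- A point `y` at least as close to `b` as `y₀` in the distance `‖S ·‖` satisfies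
`y - y₀ = O(b - y₀)`, by the triangle inequality through `b`. -/
theorem norm_sub_le_of_projection {S : F →L[ℝ] H} {c : ℝ} (hc : 0 ≤ c)
    (hS : ∀ x, ‖x‖ ≤ c * ‖S x‖) {y y₀ b : F} (h : ‖S (y - b)‖ ≤ ‖S (y₀ - b)‖) :
    ‖y - y₀‖ ≤ (2 * c * ‖S‖) * ‖b - y₀‖ := by
  have h1 : ‖S (y - y₀)‖ ≤ ‖S (y - b)‖ + ‖S (y₀ - b)‖ := by
    have : S (y - y₀) = S (y - b) - S (y₀ - b) := by rw [← map_sub]; congr 1; abel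
    rw [this]; exact norm_sub_le _ _
  have h2 : ‖S (y₀ - b)‖ ≤ ‖S‖ * ‖b - y₀‖ := by
    rw [norm_sub_rev b]; exact S.le_opNorm _
  calc ‖y - y₀‖ ≤ c * ‖S (y - y₀)‖ := hS _
    _ ≤ c * (2 * (‖S‖ * ‖b - y₀‖)) := by gcongr; linarith
    _ = _ := by ring

/-- A map `β` with injective derivative at `θo` and with a left inverse continuous at `β θo` is
Lipschitz-invertible at `θo`: continuity of the left inverse brings `θ` close to `θo` as soon as
`β θ` is close to `β θo`, and then the linearization of `β` dominates. -/
theorem exists_local_norm_sub_le {β : V → F} {θo : V} {A : V →L[ℝ] F} {a : ℝ} (ha : 0 < a)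
    (hβ : HasFDerivAt β A θo) (hA : ∀ v, ‖v‖ ≤ a * ‖A v‖) {Θ : Set V}
    {α : F → V} (hα : ∀ θ ∈ Θ, α (β θ) = θ) (hθo : θo ∈ Θ)
    (hαcont : ContinuousWithinAt α (β '' Θ) (β θo)) :
    ∃ δ > 0, ∀ θ ∈ Θ, ‖β θ - β θo‖ ≤ δ → ‖θ - θo‖ ≤ 2 * a * ‖β θ - β θo‖ := by
  have h1 := hβ.isLittleO.def (c := 1 / (2 * a)) (by positivity)
  obtain ⟨r, hr, hball⟩ := Metric.eventually_nhds_iff.1 h1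
  obtain ⟨δ, hδ, hαδ⟩ := Metric.continuousWithinAt_iff.1 hαcont r hr
  refine ⟨δ / 2, by positivity, fun θ hθ hle => ?_⟩
  have h2 : dist θ θo < r := by
    have := hαδ (Set.mem_image_of_mem β hθ) (by rw [dist_eq_norm]; linarith)
    rwa [hα θ hθ, hα θo hθo] at this
  have h3 := hball h2
  have h4 : ‖A (θ - θo)‖ ≤ ‖β θ - β θo‖ + 1 / (2 * a) * ‖θ - θo‖ := by
    have : A (θ - θo) = (β θ - β θo) - (β θ - β θo - A (θ - θo)) := by abel
    rw [this]; exact (norm_sub_le _ _).trans (by gcongr)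
  have h5 : ‖θ - θo‖ ≤ a * (‖β θ - β θo‖ + 1 / (2 * a) * ‖θ - θo‖) :=
    (hA _).trans (by gcongr)
  have h6 : a * (‖β θ - β θo‖ + 1 / (2 * a) * ‖θ - θo‖)
      = a * ‖β θ - β θo‖ + 1 / 2 * ‖θ - θo‖ := by field_simp
  linarith

/-- Away from `β θo` the distance `r = ‖β θ - β θo‖` is bounded below by `δ`, so that constants and
lower powers of `r` are absorbed by multiples of `r ^ p`; polynomial growth of the left inverse then
extends the local Lipschitz bound to all of `Θ`. -/
theorem exists_global_norm_sub_le {V F : Type*} [NormedAddCommGroup V] [NormedAddCommGroup F]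
    {β : V → F} {θo : V} {Θ : Set V} {α : F → V}
    (hα : ∀ θ ∈ Θ, α (β θ) = θ) {δ L : ℝ} (hδ : 0 < δ) (hL : 0 ≤ L)
    (hloc : ∀ θ ∈ Θ, ‖β θ - β θo‖ ≤ δ → ‖θ - θo‖ ≤ L * ‖β θ - β θo‖)
    (p : ℕ) {C : ℝ} (hC : ∀ b ∈ β '' Θ, ‖α b‖ ≤ C * (1 + ‖b‖ ^ p)) :
    ∃ K ≥ 0, ∀ θ ∈ Θ, ‖θ - θo‖ ≤ K * (‖β θ - β θo‖ + ‖β θ - β θo‖ ^ p) := by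
  set s := ‖β θo‖
  set K₁ := ‖θo‖ * (1 / δ) ^ p + |C| * ((1 / δ) ^ p + (1 + s / δ) ^ p) with hK₁
  have hK₁0 : 0 ≤ K₁ := by positivity
  refine ⟨L + K₁, by positivity, fun θ hθ => ?_⟩
  set r := ‖β θ - β θo‖ with hr
  have hr0 : 0 ≤ r := norm_nonneg _
  have hrp : 0 ≤ r ^ p := by positivity
  rcases le_total r δ with h | h
  · calc ‖θ - θo‖ ≤ L * r := hloc θ hθ h
      _ ≤ (L + K₁) * (r + r ^ p) := by gcongr <;> linarith
  · have h1 : 1 ≤ (1 / δ) ^ p * r ^ p := by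
      rw [← mul_pow]; apply one_le_pow₀; rw [one_div_mul_eq_div]; exact (one_le_div hδ).2 h
    have h2 : ‖β θ‖ ^ p ≤ (1 + s / δ) ^ p * r ^ p := by
      rw [← mul_pow]
      gcongr
      have h3 : ‖β θ‖ ≤ r + s := by
        have := norm_add_le (β θ - β θo) (β θo)
        rwa [sub_add_cancel] at this
      have h4 : s ≤ s / δ * r := by
        rw [div_mul_eq_mul_div, le_div_iff₀ hδ]; gcongr
      linarith
    have h5 : ‖θ‖ ≤ |C| * (1 + ‖β θ‖ ^ p) := by
      have := hC _ (Set.mem_image_of_mem β hθ)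
      rw [hα θ hθ] at this
      exact this.trans (by gcongr; exact le_abs_self C)
    calc ‖θ - θo‖ ≤ ‖θ‖ + ‖θo‖ := norm_sub_le _ _
      _ ≤ |C| * (1 + ‖β θ‖ ^ p) + ‖θo‖ * 1 := by linarith
      _ ≤ |C| * ((1 / δ) ^ p * r ^ p + (1 + s / δ) ^ p * r ^ p)
          + ‖θo‖ * ((1 / δ) ^ p * r ^ p) := by gcongr
      _ = K₁ * r ^ p := by rw [hK₁]; ring
      _ ≤ (L + K₁) * (r + r ^ p) := by gcongr <;> linarith

/-- First-order expansion of the minimum-distance estimate. Here `‖S ·‖` is the weighted norm and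
`T` solves the linearized least-squares problem, in the sense of the normal equations `hT`. The
minimizer `θ` need not satisfy a first-order condition: it is compared with the admissible point
`θo + T (b - β θo)`, and the near-equality of the two residuals forces `θ - θo` and
`T (b - β θo)` together by Pythagoras' theorem. -/
theorem exists_argmin_sub_linear_le {β : V → F} {θo : V} {A : V →L[ℝ] F} {S : F →L[ℝ] H}
    {T : F →L[ℝ] V} {a c : ℝ} (hc : 0 ≤ c) (ha : 0 ≤ a)
    (hβ : HasFDerivAt β A θo) (hA : ∀ v, ‖v‖ ≤ a * ‖A v‖) (hS : ∀ x, ‖x‖ ≤ c * ‖S x‖)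
    (hT : ∀ v x, inner ℝ (S (A v)) (S (A (T x) - x)) = 0)
    {Θ : Set V} (hθo : Θ ∈ 𝓝 θo) {δ L : ℝ} (hδ : 0 < δ) (hL : 0 ≤ L)
    (hloc : ∀ θ ∈ Θ, ‖β θ - β θo‖ ≤ δ → ‖θ - θo‖ ≤ L * ‖β θ - β θo‖)
    {η : ℝ} (hη : 0 < η) :
    ∃ ρ > 0, ∀ b, ∀ θ ∈ Θ, ‖b - β θo‖ ≤ ρ → (∀ θ' ∈ Θ, ‖S (β θ - b)‖ ≤ ‖S (β θ' - b)‖) →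
      ‖θ - θo - T (b - β θo)‖ ≤ η * ‖b - β θo‖ := by
  set K₀ := 2 * c * ‖S‖ with hK₀
  set M := ‖S‖ * (L * K₀ + ‖T‖) with hM
  set M' := ‖S‖ * (‖A‖ * ‖T‖ + 1) with hM'
  have hK₀0 : 0 ≤ K₀ := by positivity
  have hM0 : 0 ≤ M := by positivity
  have hM'0 : 0 ≤ M' := by positivity
  set R := (a * c) ^ 2 * (2 * M' * M + M ^ 2) with hR
  have hR0 : 0 ≤ R := by positivity
  -- The squared error comes out as at most `R * ε * ‖x‖ ^ 2`, for a linearization error `ε ≤ 1`.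
  set ε := min 1 (η ^ 2 / (R + 1)) with hε
  have hε0 : 0 < ε := by positivity
  have hε1 : ε ≤ 1 := min_le_left _ _
  have hεR : R * ε ≤ η ^ 2 := by
    have h1 : ε ≤ η ^ 2 / (R + 1) := min_le_right _ _
    rw [le_div_iff₀ (by positivity)] at h1
    nlinarith
  -- A ball inside `Θ` on which the linearization error of `β` is at most `ε * ‖θ - θo‖`.
  obtain ⟨r, hr, hball⟩ := Metric.eventually_nhds_iff.1 ((hβ.isLittleO.def hε0).and hθo)
  -- The three bounds on `‖b - β θo‖` make `hloc` applicable to `θ` and put `θ` and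
  -- `θo + T (b - β θo)` inside that ball.
  refine ⟨min (δ / (K₀ + 1)) (min (r / (2 * (L * K₀ + 1))) (r / (2 * (‖T‖ + 1)))),
    by positivity, fun b θ hθ hb hmin => ?_⟩
  set x := b - β θo with hx
  have hx0 : 0 ≤ ‖x‖ := norm_nonneg _
  have hb1 : (K₀ + 1) * ‖x‖ ≤ δ := by
    have := hb.trans (min_le_left _ _)
    rwa [le_div_iff₀' (by positivity)] at this
  have hb2 : 2 * (L * K₀ + 1) * ‖x‖ ≤ r := by
    have := (hb.trans (min_le_right _ _)).trans (min_le_left _ _)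
    rwa [le_div_iff₀' (by positivity)] at this
  have hb3 : 2 * (‖T‖ + 1) * ‖x‖ ≤ r := by
    have := (hb.trans (min_le_right _ _)).trans (min_le_right _ _)
    rwa [le_div_iff₀' (by positivity)] at this
  have hθoΘ : θo ∈ Θ := mem_of_mem_nhds hθo
  have h1 : ‖β θ - β θo‖ ≤ K₀ * ‖x‖ := norm_sub_le_of_projection hc hS (hmin θo hθoΘ)
  have h2 : ‖θ - θo‖ ≤ L * K₀ * ‖x‖ := by
    refine (hloc θ hθ (h1.trans (by linarith))).trans ?_
    rw [mul_assoc]; gcongr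
  have hTx : ‖T x‖ ≤ ‖T‖ * ‖x‖ := T.le_opNorm x
  have h3 := (hball (y := θ) (by
    rw [dist_eq_norm]; have := mul_nonneg (mul_nonneg hL hK₀0) hx0; nlinarith)).1
  have h4 := hball (y := θo + T x) (by
    rw [dist_eq_norm, add_sub_cancel_left]
    have := mul_nonneg (norm_nonneg T) hx0; nlinarith)
  have h4' := h4.1
  rw [add_sub_cancel_left] at h4'
  set e₁ := β θ - β θo - A (θ - θo) with he₁
  set e₂ := β (θo + T x) - β θo - A (T x) with he₂
  -- The residual of the linearized problem at `θ - θo` is nearly minimal.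
  have hkey : ‖S (A (θ - θo) - x)‖ ≤ ‖S (A (T x) - x)‖ + ε * M * ‖x‖ := by
    have i1 : S (A (θ - θo) - x) = S (β θ - b) - S e₁ := by
      rw [← map_sub, he₁, hx]; congr 1; abel
    have i2 : S (β (θo + T x) - b) = S (A (T x) - x) + S e₂ := by
      rw [← map_add, he₂, hx]; congr 1; abel
    have j1 : ‖S e₁‖ ≤ ‖S‖ * (ε * (L * K₀ * ‖x‖)) :=
      (S.le_opNorm _).trans (by gcongr; exact h3.trans (by gcongr))
    have j2 : ‖S e₂‖ ≤ ‖S‖ * (ε * (‖T‖ * ‖x‖)) :=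
      (S.le_opNorm _).trans (by gcongr; exact h4'.trans (by gcongr))
    have j3 := hmin _ h4.2
    rw [i2] at j3
    calc ‖S (A (θ - θo) - x)‖ ≤ ‖S (β θ - b)‖ + ‖S e₁‖ := by rw [i1]; exact norm_sub_le _ _
      _ ≤ (‖S (A (T x) - x)‖ + ‖S e₂‖) + ‖S e₁‖ := by
          gcongr; exact j3.trans (norm_add_le _ _)
      _ ≤ _ := by rw [hM]; linarith
  set w := θ - θo - T x with hw
  have hpyth : ‖S (A (θ - θo) - x)‖ ^ 2 = ‖S (A w)‖ ^ 2 + ‖S (A (T x) - x)‖ ^ 2 := by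
    have : S (A (θ - θo) - x) = S (A w) + S (A (T x) - x) := by
      have hAw : A w = A (θ - θo) - A (T x) := map_sub A _ _
      rw [← map_add, hAw]; congr 1; abel
    rw [this, pow_two, pow_two, pow_two]
    exact norm_add_sq_eq_norm_sq_add_norm_sq_of_inner_eq_zero _ _ (hT w x)
  have hbase : ‖S (A (T x) - x)‖ ≤ M' * ‖x‖ := by
    refine (S.le_opNorm _).trans ?_
    rw [hM', mul_assoc]
    gcongr
    calc ‖A (T x) - x‖ ≤ ‖A (T x)‖ + ‖x‖ := norm_sub_le _ _
      _ ≤ ‖A‖ * (‖T‖ * ‖x‖) + ‖x‖ := by gcongr; exact (A.le_opNorm _).trans (by gcongr)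
      _ = _ := by ring
  have hsq : ‖S (A w)‖ ^ 2 ≤ (2 * M' * M + M ^ 2) * ε * ‖x‖ ^ 2 := by
    have k1 : ‖S (A (θ - θo) - x)‖ ^ 2 ≤ (‖S (A (T x) - x)‖ + ε * M * ‖x‖) ^ 2 := by gcongr
    have k2 : 2 * ‖S (A (T x) - x)‖ * (ε * M * ‖x‖) ≤ 2 * (M' * ‖x‖) * (ε * M * ‖x‖) := by
      gcongr
    have k3 : ε ^ 2 * (M * ‖x‖) ^ 2 ≤ ε * (M * ‖x‖) ^ 2 := by
      gcongr; exact pow_le_of_le_one hε0.le hε1 two_ne_zero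
    have k4 : (‖S (A (T x) - x)‖ + ε * M * ‖x‖) ^ 2 = ‖S (A (T x) - x)‖ ^ 2
        + 2 * ‖S (A (T x) - x)‖ * (ε * M * ‖x‖) + ε ^ 2 * (M * ‖x‖) ^ 2 := by ring
    have k5 : (2 * M' * M + M ^ 2) * ε * ‖x‖ ^ 2
        = 2 * (M' * ‖x‖) * (ε * M * ‖x‖) + ε * (M * ‖x‖) ^ 2 := by ring
    linarith
  have hwle : ‖w‖ ≤ a * c * ‖S (A w)‖ := by
    refine (hA w).trans ?_
    rw [mul_assoc]; gcongr; exact hS _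
  refine abs_le_of_sq_le_sq' ?_ (by positivity) |>.2
  calc ‖w‖ ^ 2 ≤ (a * c * ‖S (A w)‖) ^ 2 := by gcongr
    _ = (a * c) ^ 2 * ‖S (A w)‖ ^ 2 := by ring
    _ ≤ (a * c) ^ 2 * ((2 * M' * M + M ^ 2) * ε * ‖x‖ ^ 2) := by gcongr
    _ = R * ε * ‖x‖ ^ 2 := by rw [hR]; ring
    _ ≤ η ^ 2 * ‖x‖ ^ 2 := by gcongr
    _ = (η * ‖x‖) ^ 2 := by ring

end Deterministic

/-! ### Remainders in `L²` -/

section Probability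

variable {Ω : Type*} [MeasurableSpace Ω] {P : Measure Ω}

/-- The delta method in `L²`: if `d N = o(‖x N‖)` as `x N → 0`, if
`d N = O(‖x N‖ + ‖x N‖ ^ p)` everywhere, and if the scaled families `a N * ‖x N‖` and
`a N * ‖x N‖ ^ p` are uniformly integrable from some index on, then `a N • d N → 0` in `L²`. On the
event `‖x N‖ < ρ` the local bound applies; its complement has vanishing probability. -/
theorem tendsto_eLpNorm_smul_of_remainder {F V : Type*} [NormedAddCommGroup F]
    [NormedAddCommGroup V] [NormedSpace ℝ V] {x : ℕ → Ω → F} {d : ℕ → Ω → V}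
    {a : ℕ → ℝ} (ha : Tendsto a atTop atTop) (ha0 : ∀ N, 0 ≤ a N) (p : ℕ)
    (hui : ∀ q : ℕ, q = 1 ∨ q = p → ∃ N₀ : ℕ, UniformIntegrable
      (fun (N : ℕ) ω => a (N + N₀) * ‖x (N + N₀) ω‖ ^ q) 2 P)
    {K : ℝ} (hK : 0 ≤ K)
    (hglob : ∀ᶠ N in atTop, ∀ᵐ ω ∂P, ‖d N ω‖ ≤ K * (‖x N ω‖ + ‖x N ω‖ ^ p))
    (hloc : ∀ η > 0, ∃ ρ > 0, ∀ᶠ N in atTop, ∀ᵐ ω ∂P, ‖x N ω‖ ≤ ρ → ‖d N ω‖ ≤ η * ‖x N ω‖) :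
    Tendsto (fun N => eLpNorm (fun ω => a N • d N ω) 2 P) atTop (𝓝 0) := by
  obtain ⟨N₁, hm₁, hu₁, C, hC⟩ := hui 1 (Or.inl rfl)
  obtain ⟨N₂, hm₂, hu₂, -⟩ := hui p (Or.inr rfl)
  simp only [pow_one] at hm₁ hu₁ hC
  -- the errors `x N` converge to zero in probability
  have hprob : ∀ ρ > 0, Tendsto (fun N => P {ω | ρ ≤ ‖x N ω‖}) atTop (𝓝 0) := by
    intro ρ hρ
    have hb : ∀ᶠ N in atTop, P {ω | ρ ≤ ‖x N ω‖} ≤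
        (ENNReal.ofReal (a N * ρ))⁻¹ ^ (2 : ℝ) * (C : ℝ≥0∞) ^ (2 : ℝ) := by
      filter_upwards [eventually_ge_atTop N₁, ha.eventually_gt_atTop 0] with N hN hpos
      obtain ⟨k, rfl⟩ := Nat.exists_eq_add_of_le' hN
      have := meas_ge_le_mul_pow_eLpNorm_enorm P (p := 2) two_ne_zero ENNReal.ofNat_ne_top
        (hm₁ k) (ε := ENNReal.ofReal (a (k + N₁) * ρ))
        (by rw [ENNReal.ofReal_ne_zero_iff]; positivity) (by simp)
      simp only [ENNReal.toReal_ofNat] at this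
      refine (measure_mono ?_).trans (this.trans ?_)
      · intro ω hω
        simp only [Set.mem_ofPred_eq] at hω ⊢
        rw [Real.enorm_eq_ofReal (by positivity)]
        gcongr
      · gcongr; exact hC k
    refine tendsto_of_tendsto_of_tendsto_of_le_of_le' tendsto_const_nhds ?_
      (Eventually.of_forall fun _ => zero_le) hb
    have h1 : Tendsto (fun N => (ENNReal.ofReal (a N * ρ))⁻¹) atTop (𝓝 0) := by
      rw [← ENNReal.inv_top]
      exact (ENNReal.tendsto_ofReal_nhds_top.2 (ha.atTop_mul_const hρ)).inv
    have h2 := ENNReal.Tendsto.mul_const (b := (C : ℝ≥0∞) ^ (2 : ℝ)) (h1.ennrpow_const 2)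
      (Or.inr (by simp))
    simpa using h2
  have key : ∀ ε : ℝ, 0 < ε → ∀ᶠ N in atTop,
      eLpNorm (fun ω => a N • d N ω) 2 P ≤ ENNReal.ofReal ((C + 2 * K) * ε) := by
    intro ε hε
    obtain ⟨ρ, hρ, hρd⟩ := hloc ε hε
    obtain ⟨δ₁, hδ₁, hs₁⟩ := hu₁ hε
    obtain ⟨δ₂, hδ₂, hs₂⟩ := hu₂ hε
    filter_upwards [hρd, hglob, eventually_ge_atTop N₁, eventually_ge_atTop N₂,
      (hprob ρ hρ).eventually_le_const (u := ENNReal.ofReal δ₁) (by simpa using hδ₁),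
      (hprob ρ hρ).eventually_le_const (u := ENNReal.ofReal δ₂) (by simpa using hδ₂)]
      with N h1 h2 hN₁ hN₂ hP₁ hP₂
    obtain ⟨k₁, hk₁⟩ := Nat.exists_eq_add_of_le' hN₁
    obtain ⟨k₂, hk₂⟩ := Nat.exists_eq_add_of_le' hN₂
    -- `x N` need not be measurable, so the exceptional event is replaced by a measurable hull.
    set s := toMeasurable P {ω | ρ ≤ ‖x N ω‖} with hs
    have hsm : MeasurableSet s := measurableSet_toMeasurable _ _
    have e₁ := hs₁ k₁ s hsm (by rw [hs, measure_toMeasurable]; exact hP₁)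
    have e₂ := hs₂ k₂ s hsm (by rw [hs, measure_toMeasurable]; exact hP₂)
    have c₁ := hC k₁
    have m₁ := hm₁ k₁
    have m₂ := hm₂ k₂
    beta_reduce at e₁ e₂ m₂
    rw [← hk₁] at e₁ c₁ m₁
    rw [← hk₂] at e₂ m₂
    set f₁ : Ω → ℝ := fun ω => a N * ‖x N ω‖ with hf₁
    set f₂ : Ω → ℝ := fun ω => a N * ‖x N ω‖ ^ p with hf₂
    have hle : ∀ᵐ ω ∂P, ‖a N • d N ω‖ ≤
        ‖(ε • f₁ + (K • s.indicator f₁ + K • s.indicator f₂)) ω‖ := by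
      filter_upwards [h1, h2] with ω h1 h2
      have haN := ha0 N
      have hf₁0 : 0 ≤ f₁ ω := by positivity
      have hf₂0 : 0 ≤ f₂ ω := by positivity
      rw [norm_smul, Real.norm_of_nonneg haN]
      refine le_trans ?_ (le_abs_self _)
      simp only [Pi.add_apply, Pi.smul_apply, smul_eq_mul]
      by_cases hω : ω ∈ s
      · rw [Set.indicator_of_mem hω, Set.indicator_of_mem hω]
        have := mul_le_mul_of_nonneg_left h2 haN
        have := mul_nonneg hε.le hf₁0
        simp only [hf₁, hf₂] at *
        linarith
      · rw [Set.indicator_of_notMem hω, Set.indicator_of_notMem hω]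
        have hlt : ¬ ρ ≤ ‖x N ω‖ := fun h => hω (subset_toMeasurable _ _ h)
        have := mul_le_mul_of_nonneg_left (h1 (not_le.1 hlt).le) haN
        simp only [hf₁]
        linarith
    have i₁ := m₁.indicator hsm
    have i₂ := m₂.indicator hsm
    calc eLpNorm (fun ω => a N • d N ω) 2 P
        ≤ eLpNorm (ε • f₁ + (K • s.indicator f₁ + K • s.indicator f₂)) 2 P :=
          eLpNorm_mono_ae hle
      _ ≤ eLpNorm (ε • f₁) 2 P + (eLpNorm (K • s.indicator f₁) 2 P
            + eLpNorm (K • s.indicator f₂) 2 P) := by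
          refine (eLpNorm_add_le (m₁.const_smul ε) ((i₁.const_smul K).add (i₂.const_smul K))
            one_le_two).trans ?_
          gcongr
          exact eLpNorm_add_le (i₁.const_smul K) (i₂.const_smul K) one_le_two
      _ ≤ ENNReal.ofReal ε * ENNReal.ofReal C + (ENNReal.ofReal K * ENNReal.ofReal ε
            + ENNReal.ofReal K * ENNReal.ofReal ε) := by
          rw [eLpNorm_const_smul, eLpNorm_const_smul, eLpNorm_const_smul,
            Real.enorm_eq_ofReal hε.le, Real.enorm_eq_ofReal hK, ENNReal.ofReal_coe_nnreal]
          gcongr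
      _ = ENNReal.ofReal ((C + 2 * K) * ε) := by
          have : (0 : ℝ) ≤ C := C.2
          rw [← ENNReal.ofReal_mul hε.le, ← ENNReal.ofReal_mul hK,
            ← ENNReal.ofReal_add (by positivity) (by positivity),
            ← ENNReal.ofReal_add (by positivity) (by positivity)]
          congr 1; ring
  rw [ENNReal.tendsto_nhds_zero]
  intro ε' hε'
  rcases eq_or_ne ε' ∞ with rfl | htop
  · simp
  have hC0 : (0 : ℝ) ≤ C := C.2
  have hpos : 0 < ε'.toReal := ENNReal.toReal_pos hε'.ne' htop
  filter_upwards [key (ε'.toReal / (C + 2 * K + 1)) (by positivity)] with N hN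
  refine hN.trans ?_
  rw [ENNReal.ofReal_le_iff_le_toReal htop, mul_div_assoc', div_le_iff₀ (by positivity)]
  nlinarith

/-! ### Covariance matrices -/

/-- A Cauchy–Schwarz bound for the covariance in terms of the uncentered `L²` seminorms; the
factor `2` pays for not centering. -/
theorem abs_covariance_le_eLpNorm [IsProbabilityMeasure P] {X Y : Ω → ℝ} (hX : MemLp X 2 P)
    (hY : MemLp Y 2 P) :
    |cov[X, Y; P]| ≤ 2 * ((eLpNorm X 2 P).toReal * (eLpNorm Y 2 P).toReal) := by
  have h1 : ∀ {X Y : Ω → ℝ} (hX : MemLp X 2 P) (hY : MemLp Y 2 P),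
      |∫ ω, X ω * Y ω ∂P| ≤ (eLpNorm X 2 P).toReal * (eLpNorm Y 2 P).toReal := by
    intro X Y hX hY
    have h := norm_inner_le_norm (𝕜 := ℝ) (hX.toLp X) (hY.toLp Y)
    rw [L2.inner_def, Lp.norm_toLp, Lp.norm_toLp] at h
    convert h using 1
    rw [Real.norm_eq_abs]
    congr 1
    refine integral_congr_ae ?_
    filter_upwards [hX.coeFn_toLp, hY.coeFn_toLp] with ω h1 h2
    rw [h1, h2]; simp [mul_comm]
  have h2 : ∀ {X : Ω → ℝ} (hX : MemLp X 2 P), |∫ ω, X ω ∂P| ≤ (eLpNorm X 2 P).toReal := by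
    intro X hX
    have h := h1 hX (memLp_const (1 : ℝ))
    rw [eLpNorm_const _ two_ne_zero (IsProbabilityMeasure.ne_zero P)] at h
    simpa using h
  rw [covariance_eq_sub hX hY]
  have a1 := h1 hX hY
  have a2 : |(∫ ω, X ω ∂P) * ∫ ω, Y ω ∂P| ≤ (eLpNorm X 2 P).toReal * (eLpNorm Y 2 P).toReal := by
    rw [abs_mul]
    exact mul_le_mul (h2 hX) (h2 hY) (abs_nonneg _) ENNReal.toReal_nonneg
  refine (abs_sub _ _).trans ?_
  simp only [Pi.mul_apply]
  linarith

variable {ι κ : Type*} [Fintype ι]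

/-- A perturbation tending to zero in `L²` does not change the limit of the covariance matrices. -/
theorem tendsto_covMatrix_add [IsProbabilityMeasure P] {X D : ℕ → Ω → ι → ℝ}
    (hX : ∀ᶠ N in atTop, MemLp (X N) 2 P) (hD : ∀ᶠ N in atTop, MemLp (D N) 2 P)
    {C : ℝ≥0} (hXC : ∀ᶠ N in atTop, eLpNorm (X N) 2 P ≤ C)
    (hD0 : Tendsto (fun N => eLpNorm (D N) 2 P) atTop (𝓝 0)) {S : Matrix ι ι ℝ}
    (hS : Tendsto (fun N => covMatrix P (X N)) atTop (𝓝 S)) :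
    Tendsto (fun N => covMatrix P (fun ω => X N ω + D N ω)) atTop (𝓝 S) := by
  refine tendsto_pi_nhds.2 fun i => tendsto_pi_nhds.2 fun j => ?_
  have hSij := tendsto_pi_nhds.1 (tendsto_pi_nhds.1 hS i) j
  have hcoord : ∀ (Z : Ω → ι → ℝ) (i : ι), eLpNorm (fun ω => Z ω i) 2 P ≤ eLpNorm Z 2 P :=
    fun Z i => eLpNorm_mono fun ω => norm_le_pi_norm (Z ω) i
  have hd0 : Tendsto (fun N => (eLpNorm (D N) 2 P).toReal) atTop (𝓝 0) := by
    have := (ENNReal.tendsto_toReal ENNReal.zero_ne_top).comp hD0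
    rwa [ENNReal.toReal_zero] at this
  have hlim : Tendsto (fun N => 4 * C * (eLpNorm (D N) 2 P).toReal
      + 2 * ((eLpNorm (D N) 2 P).toReal * (eLpNorm (D N) 2 P).toReal)) atTop (𝓝 0) := by
    simpa using (hd0.const_mul (4 * (C : ℝ))).add ((hd0.mul hd0).const_mul 2)
  have hdiff : Tendsto (fun N => covMatrix P (fun ω => X N ω + D N ω) i j
      - covMatrix P (X N) i j) atTop (𝓝 0) := by
    refine squeeze_zero_norm' ?_ hlim
    filter_upwards [hX, hD, hXC] with N hX hD hXC
    have hXi := fun i => memLp_pi_iff.1 hX i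
    have hDi := fun i => memLp_pi_iff.1 hD i
    have tX : ∀ i, (eLpNorm (fun ω => X N ω i) 2 P).toReal ≤ C := fun i =>
      ENNReal.toReal_le_coe_of_le_coe ((hcoord _ i).trans hXC)
    have tD : ∀ i, (eLpNorm (fun ω => D N ω i) 2 P).toReal ≤ (eLpNorm (D N) 2 P).toReal :=
      fun i => ENNReal.toReal_mono hD.eLpNorm_ne_top (hcoord _ i)
    have hexp : covMatrix P (fun ω => X N ω + D N ω) i j - covMatrix P (X N) i j
        = cov[fun ω => X N ω i, fun ω => D N ω j; P] + cov[fun ω => D N ω i, fun ω => X N ω j; P]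
          + cov[fun ω => D N ω i, fun ω => D N ω j; P] := by
      have : cov[(fun ω => X N ω i) + (fun ω => D N ω i),
          (fun ω => X N ω j) + (fun ω => D N ω j); P]
          = _ := covariance_add_left (hXi i) (hDi i) ((hXi j).add (hDi j))
      rw [covariance_add_right (hXi i) (hXi j) (hDi j),
        covariance_add_right (hDi i) (hXi j) (hDi j)] at this
      change cov[(fun ω => X N ω i) + (fun ω => D N ω i),
          (fun ω => X N ω j) + (fun ω => D N ω j); P]
        - cov[fun ω => X N ω i, fun ω => X N ω j; P] = _
      rw [this]; ring
    rw [hexp, Real.norm_eq_abs]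
    have b1 := (abs_covariance_le_eLpNorm (hXi i) (hDi j)).trans
      (mul_le_mul_of_nonneg_left (mul_le_mul (tX i) (tD j) ENNReal.toReal_nonneg C.2) zero_le_two)
    have b2 := (abs_covariance_le_eLpNorm (hDi i) (hXi j)).trans
      (mul_le_mul_of_nonneg_left (mul_le_mul (tD i) (tX j) ENNReal.toReal_nonneg
        ENNReal.toReal_nonneg) zero_le_two)
    have b3 := (abs_covariance_le_eLpNorm (hDi i) (hDi j)).trans
      (mul_le_mul_of_nonneg_left (mul_le_mul (tD i) (tD j) ENNReal.toReal_nonneg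
        ENNReal.toReal_nonneg) zero_le_two)
    refine (abs_add_three _ _ _).trans ?_
    linarith
  simpa using hdiff.add hSij

theorem covMatrix_mulVec [IsFiniteMeasure P] {X : Ω → ι → ℝ} (hX : MemLp X 2 P)
    (T : Matrix κ ι ℝ) :
    covMatrix P (fun ω => T *ᵥ X ω) = T * covMatrix P X * Tᵀ := by
  have hXi := fun i => memLp_pi_iff.1 hX i
  ext i j
  change cov[fun ω => ∑ k, T i k * X ω k, fun ω => ∑ l, T j l * X ω l; P] = _
  rw [covariance_fun_sum_fun_sum (fun k => (hXi k).const_mul _) (fun l => (hXi l).const_mul _)]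
  simp only [covariance_const_mul_left, covariance_const_mul_right, Matrix.mul_apply,
    Matrix.transpose_apply, covMatrix, Matrix.of_apply, Finset.sum_mul]
  rw [Finset.sum_comm]
  refine Finset.sum_congr rfl fun l _ => Finset.sum_congr rfl fun k _ => by ring

theorem covMatrix_posSemidef [IsFiniteMeasure P] {X : Ω → ι → ℝ} (hX : MemLp X 2 P) :
    (covMatrix P X).PosSemidef := by
  refine Matrix.PosSemidef.of_dotProduct_mulVec_nonneg ?_ fun x => ?_
  · ext i j
    simp [covMatrix, covariance_comm]
  · have hXi := fun i => memLp_pi_iff.1 hX i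
    have h : star x ⬝ᵥ covMatrix P X *ᵥ x = Var[fun ω => ∑ k, x k * X ω k; P] := by
      rw [← covariance_self
        (memLp_finsetSum _ fun k _ => (hXi k).const_mul (x k)).aestronglyMeasurable.aemeasurable,
        covariance_fun_sum_fun_sum (fun k => (hXi k).const_mul _) (fun l => (hXi l).const_mul _)]
      simp only [covariance_const_mul_left, covariance_const_mul_right, dotProduct, Matrix.mulVec,
        covMatrix, Matrix.of_apply, Finset.mul_sum, star_trivial]
      refine Finset.sum_congr rfl fun l _ => Finset.sum_congr rfl fun k _ => by ring
    rw [h]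
    exact variance_nonneg _ _

theorem posSemidef_of_tendsto {S : ℕ → Matrix ι ι ℝ} {S₀ : Matrix ι ι ℝ}
    (h : ∀ᶠ N in atTop, (S N).PosSemidef) (hS : Tendsto S atTop (𝓝 S₀)) : S₀.PosSemidef := by
  refine Matrix.PosSemidef.of_dotProduct_mulVec_nonneg ?_ fun x => ?_
  · have h1 : Tendsto (fun N => (S N)ᴴ) atTop (𝓝 S₀ᴴ) :=
      (continuous_id.matrix_conjTranspose.tendsto _).comp hS
    exact tendsto_nhds_unique (h1.congr' (h.mono fun N hN => hN.isHermitian)) hS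
  · have hc : Continuous fun M : Matrix ι ι ℝ => star x ⬝ᵥ M *ᵥ x :=
      Continuous.dotProduct continuous_const (continuous_id.matrix_mulVec continuous_const)
    exact ge_of_tendsto ((hc.tendsto _).comp hS)
      (h.mono fun N hN => hN.dotProduct_mulVec_nonneg x)

end Probability

/-! ### Weighted least squares -/

section WeightedNorm

variable {ι κ : Type*} [Fintype ι] [Fintype κ]

open scoped MatrixOrder Matrix.Norms.L2Operator in
/-- A positive semidefinite quadratic form is the squared norm of a linear image in a Euclidean
space, which makes Hilbert space geometry available for the weighted distance. -/
theorem exists_clm_inner_eq_dotProduct_mulVec {W : Matrix ι ι ℝ} (hW : W.PosSemidef) :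
    ∃ S : (ι → ℝ) →L[ℝ] EuclideanSpace ℝ ι, ∀ x y, inner ℝ (S x) (S y) = x ⬝ᵥ W *ᵥ y := by
  classical
  obtain ⟨R, hR⟩ := CStarAlgebra.nonneg_iff_eq_star_mul_self.mp hW.nonneg
  refine ⟨LinearMap.toContinuousLinearMap
    ((WithLp.linearEquiv 2 ℝ (ι → ℝ)).symm.toLinearMap ∘ₗ R.mulVecLin), fun x y => ?_⟩
  have h1 : inner ℝ (WithLp.toLp 2 (R *ᵥ x)) (WithLp.toLp 2 (R *ᵥ y)) = (R *ᵥ y) ⬝ᵥ (R *ᵥ x) := by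
    simp [EuclideanSpace.inner_toLp_toLp]
  refine h1.trans ?_
  rw [hR, Matrix.star_eq_conjTranspose, Matrix.conjTranspose_eq_transpose_of_trivial,
    ← Matrix.mulVec_mulVec, dotProduct_comm, Matrix.dotProduct_mulVec x, Matrix.vecMul_transpose]

theorem exists_pos_bound_of_injective {E F : Type*} [NormedAddCommGroup E] [NormedSpace ℝ E]
    [FiniteDimensional ℝ E] [NormedAddCommGroup F] [NormedSpace ℝ F] (A : E →L[ℝ] F)
    (hA : ∀ x, A x = 0 → x = 0) : ∃ a > 0, ∀ x, ‖x‖ ≤ a * ‖A x‖ := by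
  obtain ⟨K, hK, h⟩ := LinearMap.exists_antilipschitzWith (A : E →ₗ[ℝ] F)
    (LinearMap.ker_eq_bot'.2 hA)
  exact ⟨K, hK, fun x => ZeroHomClass.bound_of_antilipschitz A h x⟩

/-- The normal equations: the residual of the weighted least-squares fit of `x` by `G` is
`W`-orthogonal to the range of `G`. -/
theorem dotProduct_mulVec_projection [DecidableEq κ] {G : Matrix ι κ ℝ} {W : Matrix ι ι ℝ}
    (hH : IsUnit (Gᵀ * W * G).det) (v : κ → ℝ) (x : ι → ℝ) :
    (G *ᵥ v) ⬝ᵥ W *ᵥ (G *ᵥ (((Gᵀ * W * G)⁻¹ * Gᵀ * W) *ᵥ x) - x) = 0 := by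
  rw [← Matrix.vecMul_transpose, ← Matrix.dotProduct_mulVec, Matrix.mulVec_sub,
    Matrix.mulVec_sub]
  simp only [Matrix.mulVec_mulVec]
  have : Gᵀ * (W * (G * ((Gᵀ * W * G)⁻¹ * Gᵀ * W))) = Gᵀ * W := by
    calc _ = (Gᵀ * W * G) * (Gᵀ * W * G)⁻¹ * (Gᵀ * W) := by simp only [Matrix.mul_assoc]
      _ = _ := by rw [Matrix.mul_nonsing_inv _ hH, Matrix.one_mul]
  rw [this, sub_self, dotProduct_zero]

/-- The covariance of the projected vector: with `W` inverse to the covariance `S`, the sandwich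
`T S Tᵀ` collapses to `(Gᵀ W G)⁻¹`. -/
theorem projection_mul_inv_mul_transpose [DecidableEq ι] [DecidableEq κ] {G : Matrix ι κ ℝ}
    {S W : Matrix ι ι ℝ} (hS : Sᵀ = S) (hSu : IsUnit S.det) (hW : W = S⁻¹)
    (hH : IsUnit (Gᵀ * W * G).det) :
    ((Gᵀ * W * G)⁻¹ * Gᵀ * W) * S * ((Gᵀ * W * G)⁻¹ * Gᵀ * W)ᵀ = (Gᵀ * W * G)⁻¹ := by
  have hWt : Wᵀ = W := by rw [hW, Matrix.transpose_nonsing_inv, hS]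
  have hWS : W * S = 1 := by rw [hW, Matrix.nonsing_inv_mul _ hSu]
  have hHt : (Gᵀ * W * G)ᵀ = Gᵀ * W * G := by
    simp only [Matrix.transpose_mul, Matrix.transpose_transpose, hWt, Matrix.mul_assoc]
  rw [Matrix.transpose_mul, Matrix.transpose_mul, Matrix.transpose_transpose, hWt,
    Matrix.transpose_nonsing_inv, hHt]
  calc _ = (Gᵀ * W * G)⁻¹ * (Gᵀ * (W * S) * W * G) * (Gᵀ * W * G)⁻¹ := by
        simp only [Matrix.mul_assoc]
    _ = _ := by rw [hWS, Matrix.mul_one, Matrix.nonsing_inv_mul _ hH, Matrix.one_mul]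

end WeightedNorm

/-! ### The remainder of the indirect estimate and its covariance -/

/-- The two bounds on the remainder of the linearized estimate `θ ≈ θo + T (b - β θo)`: polynomial
growth for all `b`, and `o(‖b - β θo‖)` near `β θo`. -/
theorem exists_argmin_remainder_bounds {n m : ℕ} {Θ : Set (Fin n → ℝ)} {θo : Fin n → ℝ}
    (hθo : θo ∈ interior Θ) {β : (Fin n → ℝ) → (Fin m → ℝ)} (hβ : DifferentiableAt ℝ β θo)
    {α : (Fin m → ℝ) → (Fin n → ℝ)} (hα : ∀ θ ∈ Θ, α (β θ) = θ)
    (hαcont : ContinuousWithinAt α (β '' Θ) (β θo)) (p : ℕ)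
    (hαgrowth : ∃ C : ℝ, ∀ b ∈ β '' Θ, ‖α b‖ ≤ C * (1 + ‖b‖ ^ p))
    {W : Matrix (Fin m) (Fin m) ℝ} (hW : W.PosDef) {G : Matrix (Fin m) (Fin n) ℝ}
    (hG : G = jacobian β θo) (hH : IsUnit (Gᵀ * W * G).det)
    {T : Matrix (Fin n) (Fin m) ℝ} (hT : T = (Gᵀ * W * G)⁻¹ * Gᵀ * W) :
    (∃ K ≥ 0, ∀ b θ, IsArgmin (stepTwoCost β W b) Θ θ →
      ‖θ - θo - T *ᵥ (b - β θo)‖ ≤ K * (‖b - β θo‖ + ‖b - β θo‖ ^ p)) ∧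
    ∀ η > 0, ∃ ρ > 0, ∀ b θ, IsArgmin (stepTwoCost β W b) Θ θ → ‖b - β θo‖ ≤ ρ →
      ‖θ - θo - T *ᵥ (b - β θo)‖ ≤ η * ‖b - β θo‖ := by
  obtain ⟨S, hS⟩ := exists_clm_inner_eq_dotProduct_mulVec hW.posSemidef
  obtain ⟨C, hC⟩ := hαgrowth
  set A := fderiv ℝ β θo with hAdef
  have hAG : ∀ v, A v = G *ᵥ v := fun v => by
    rw [hG, jacobian, LinearMap.toMatrix'_mulVec]; rfl
  set Tl : (Fin m → ℝ) →L[ℝ] (Fin n → ℝ) := LinearMap.toContinuousLinearMap T.mulVecLin with hTl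
  have hTl' : ∀ x, Tl x = T *ᵥ x := fun x => rfl
  have hcost : ∀ b θ, stepTwoCost β W b θ = ‖S (β θ - b)‖ ^ 2 := fun b θ => by
    rw [stepTwoCost, ← hS, real_inner_self_eq_norm_sq]
  have hmin : ∀ {b θ}, IsArgmin (stepTwoCost β W b) Θ θ →
      ∀ θ' ∈ Θ, ‖S (β θ - b)‖ ≤ ‖S (β θ' - b)‖ := by
    intro b θ h θ' hθ'
    have h1 : stepTwoCost β W b θ ≤ stepTwoCost β W b θ' := h.2 hθ'
    rw [hcost, hcost] at h1
    exact (sq_le_sq₀ (norm_nonneg _) (norm_nonneg _)).1 h1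
  obtain ⟨c, hc, hSc⟩ := exists_pos_bound_of_injective S fun x hx => by
    by_contra hne
    have h1 := hW.dotProduct_mulVec_pos hne
    rw [star_trivial, ← hS, hx, inner_zero_left] at h1
    exact lt_irrefl _ h1
  obtain ⟨a, ha, hAa⟩ := exists_pos_bound_of_injective A fun v hv => by
    rw [hAG] at hv
    have h1 : (Gᵀ * W * G) *ᵥ v = 0 := by
      rw [← Matrix.mulVec_mulVec, hv, Matrix.mulVec_zero]
    exact Matrix.eq_zero_of_mulVec_eq_zero hH.ne_zero h1
  have hθoΘ : θo ∈ Θ := interior_subset hθo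
  obtain ⟨δ, hδ, hloc⟩ := exists_local_norm_sub_le ha hβ.hasFDerivAt hAa hα hθoΘ hαcont
  refine ⟨?_, fun η hη => ?_⟩
  · obtain ⟨K, hK, hglob⟩ := exists_global_norm_sub_le hα hδ (by positivity) hloc p hC
    set K₀ := 2 * c * ‖S‖
    have hK₀ : 0 ≤ K₀ := by positivity
    refine ⟨K * (K₀ + K₀ ^ p) + ‖Tl‖, by positivity, fun b θ hθ => ?_⟩
    have h1 : ‖β θ - β θo‖ ≤ K₀ * ‖b - β θo‖ :=
      norm_sub_le_of_projection hc.le hSc (hmin hθ θo hθoΘ)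
    have h2 := hglob θ hθ.1
    set r := ‖b - β θo‖ with hr
    have hr0 : 0 ≤ r := norm_nonneg _
    have hrp : 0 ≤ r ^ p := by positivity
    have h3 : ‖T *ᵥ (b - β θo)‖ ≤ ‖Tl‖ * r := Tl.le_opNorm _
    have hKp : 0 ≤ K₀ ^ p := by positivity
    calc ‖θ - θo - T *ᵥ (b - β θo)‖ ≤ ‖θ - θo‖ + ‖T *ᵥ (b - β θo)‖ := norm_sub_le _ _
      _ ≤ K * (K₀ * r + (K₀ * r) ^ p) + ‖Tl‖ * r := by
          gcongr; exact h2.trans (by gcongr)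
      _ = K * (K₀ * r + K₀ ^ p * r ^ p) + ‖Tl‖ * r := by rw [mul_pow]
      _ ≤ K * (K₀ * (r + r ^ p) + K₀ ^ p * (r + r ^ p)) + ‖Tl‖ * (r + r ^ p) := by
          gcongr <;> linarith
      _ = _ := by ring
  · obtain ⟨ρ, hρ, h⟩ := exists_argmin_sub_linear_le (T := Tl) hc.le ha.le hβ.hasFDerivAt hAa hSc
      (fun v x => by
        rw [hS, hAG, hAG, hTl', hT]; exact dotProduct_mulVec_projection hH v x)
      (mem_interior_iff_mem_nhds.1 hθo) hδ (by positivity) hloc hη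
    exact ⟨ρ, hρ, fun b θ hθ hb => h b θ hθ.1 hb (hmin hθ)⟩

end IndirectInference

theorem mainTheorem1 {Ω : Type*} [MeasurableSpace Ω] (P : Measure Ω) [IsProbabilityMeasure P]
    {n m : ℕ}
    -- the Wiener model class, the true parameter and the linear auxiliary model class
    (Θ : Set (Fin n → ℝ)) (g : (Fin n → ℝ) → ℕ → ℝ) (f : ℝ → ℝ) (u v e : ℤ → Ω → ℝ)
    (σv2 σe2 : ℝ≥0)
    (hmodel : IndirectInference.IsStochasticWienerModel P Θ g f u v e σv2 σe2)
    (θo : Fin n → ℝ) (hθo : θo ∈ interior Θ)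
    (B : Set (Fin m → ℝ)) (h : (Fin m → ℝ) → ℕ → ℝ)
    (hlin : ∀ b ∈ B, IndirectInference.StableFilter (h b))
    -- the binding function
    (β : (Fin n → ℝ) → (Fin m → ℝ))
    (hβ : ∀ θ ∈ Θ, IndirectInference.IsArgmin
      (fun b => IndirectInference.limitCost P g h f u v e b θ) B (β θ))
    (hβdiff : DifferentiableAt ℝ β θo)
    -- its left inverse
    (α : (Fin m → ℝ) → (Fin n → ℝ)) (hα : ∀ θ ∈ Θ, α (β θ) = θ)
    (hαcont : ContinuousWithinAt α (β '' Θ) (β θo))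
    (p : ℕ) (hp : 1 ≤ p) (hαgrowth : ∃ C : ℝ, ∀ b ∈ β '' Θ, ‖α b‖ ≤ C * (1 + ‖b‖ ^ p))
    -- Step 1: the auxiliary estimate from the data generated by the true system
    (βhat : ℕ → Ω → (Fin m → ℝ)) (hβhat_meas : ∀ N, AEMeasurable (βhat N) P)
    (hβhat : ∀ᶠ N in atTop, ∀ᵐ ω ∂P, IndirectInference.IsArgmin
      (IndirectInference.empiricalCost h (fun s => u s ω)
        (IndirectInference.wienerOutput f (g θo) (fun s => u s ω) (fun s => v s ω)
          (fun s => e s ω)) N) B (βhat N ω))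
    (hβhat_ui : ∀ q : ℕ, q = 1 ∨ q = p → ∃ N₀ : ℕ, UniformIntegrable
      (fun (N : ℕ) ω => √((N + N₀ : ℕ) : ℝ) * ‖βhat (N + N₀) ω - β θo‖ ^ q) 2 P)
    -- the optimal weighting matrix
    (Sig W : Matrix (Fin m) (Fin m) ℝ)
    (hSig : Tendsto (fun N : ℕ => IndirectInference.covMatrix P
      (fun ω => √(N : ℝ) • (βhat N ω - β θo))) atTop (𝓝 Sig))
    (hSig_inv : IsUnit Sig.det) (hW : W = Sig⁻¹)
    -- Step 2: the analytic indirect inference estimate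
    (θhat : ℕ → Ω → (Fin n → ℝ)) (hθhat_meas : ∀ N, AEMeasurable (θhat N) P)
    (hθhat : ∀ᶠ N in atTop, ∀ᵐ ω ∂P, IndirectInference.IsArgmin
      (IndirectInference.stepTwoCost β W (βhat N ω)) Θ (θhat N ω))
    -- the Jacobian of the binding function, with invertible limiting Hessian
    (G : Matrix (Fin m) (Fin n) ℝ) (hG : G = IndirectInference.jacobian β θo)
    (hHess : IsUnit (Gᵀ * W * G).det) :
    (∀ᶠ N : ℕ in atTop, MemLp (fun ω => √(N : ℝ) • (θhat N ω - θo)) 2 P) ∧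
    Tendsto (fun N : ℕ => IndirectInference.covMatrix P
      (fun ω => √(N : ℝ) • (θhat N ω - θo))) atTop (𝓝 (Gᵀ * W * G)⁻¹) := by
  set T := (Gᵀ * W * G)⁻¹ * Gᵀ * W with hT
  set X : ℕ → Ω → (Fin m → ℝ) := fun N ω => √(N : ℝ) • (βhat N ω - β θo) with hX
  set R : ℕ → Ω → (Fin n → ℝ) := fun N ω => θhat N ω - θo - T *ᵥ (βhat N ω - β θo) with hR
  have hXm : ∀ N, AEStronglyMeasurable (X N) P := fun (N : ℕ) =>
    ((hβhat_meas N).sub_const (β θo)).aestronglyMeasurable.const_smul (√(N : ℝ))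
  have hTcont : Continuous fun x : Fin m → ℝ => T *ᵥ x :=
    continuous_const.matrix_mulVec continuous_id
  have hRm : ∀ N, AEStronglyMeasurable (R N) P := fun (N : ℕ) =>
    ((hθhat_meas N).sub_const _).aestronglyMeasurable.sub
      (hTcont.comp_aestronglyMeasurable ((hβhat_meas N).sub_const _).aestronglyMeasurable)
  obtain ⟨C, hXC⟩ : ∃ C : ℝ≥0, ∀ᶠ N in atTop, eLpNorm (X N) 2 P ≤ C := by
    obtain ⟨N₀, -, -, C, hC⟩ := hβhat_ui 1 (Or.inl rfl)
    refine ⟨C, ?_⟩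
    filter_upwards [eventually_ge_atTop N₀] with N hN
    obtain ⟨k, rfl⟩ := Nat.exists_eq_add_of_le' hN
    refine le_trans (eLpNorm_mono fun ω => ?_) (hC k)
    simp [hX, norm_smul]
  have hXL : ∀ᶠ N in atTop, MemLp (X N) 2 P := by
    filter_upwards [hXC] with N hN
    exact ⟨hXm N, hN.trans_lt ENNReal.coe_lt_top⟩
  -- The limit covariance is positive semidefinite, hence positive definite as it is invertible.
  have hSigPSD : Sig.PosSemidef := IndirectInference.posSemidef_of_tendsto
    (hXL.mono fun N hN => IndirectInference.covMatrix_posSemidef hN) hSig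
  have hSigPD : Sig.PosDef :=
    hSigPSD.posDef_iff_isUnit.2 ((Matrix.isUnit_iff_isUnit_det _).2 hSig_inv)
  have hWPD : W.PosDef := hW ▸ hSigPD.inv
  obtain ⟨⟨K, hK, hglob⟩, hloc⟩ := IndirectInference.exists_argmin_remainder_bounds hθo hβdiff hα
    hαcont p hαgrowth hWPD hG hHess hT
  have hR0 : Tendsto (fun N : ℕ => eLpNorm (fun ω => √(N : ℝ) • R N ω) 2 P) atTop (𝓝 0) := by
    refine IndirectInference.tendsto_eLpNorm_smul_of_remainder
      (x := fun N ω => βhat N ω - β θo) (a := fun N => √(N : ℝ))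
      (Real.tendsto_sqrt_atTop.comp tendsto_natCast_atTop_atTop) (fun N => Real.sqrt_nonneg _)
      p hβhat_ui hK ?_ fun η hη => ?_
    · filter_upwards [hθhat] with N hN
      filter_upwards [hN] with ω hω using hglob _ _ hω
    · obtain ⟨ρ, hρ, h⟩ := hloc η hη
      refine ⟨ρ, hρ, ?_⟩
      filter_upwards [hθhat] with N hN
      filter_upwards [hN] with ω hω using h _ _ hω
  have hRL : ∀ᶠ N : ℕ in atTop, MemLp (fun ω => √(N : ℝ) • R N ω) 2 P := by
    filter_upwards [hR0.eventually_lt_const ENNReal.zero_lt_top] with N hN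
    exact ⟨(hRm N).const_smul (√(N : ℝ)), hN⟩
  set Tl : (Fin m → ℝ) →L[ℝ] (Fin n → ℝ) := LinearMap.toContinuousLinearMap T.mulVecLin with hTl
  have hTXL : ∀ᶠ N in atTop, MemLp (fun ω => T *ᵥ X N ω) 2 P := by
    filter_upwards [hXL] with N hN using Tl.comp_memLp' hN
  have hdecomp : ∀ N : ℕ, (fun ω => √(N : ℝ) • (θhat N ω - θo))
      = fun ω => T *ᵥ X N ω + √(N : ℝ) • R N ω := by
    intro N
    funext ω
    simp only [hX, hR, Matrix.mulVec_smul, ← smul_add, add_sub_cancel]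
  have hcovTX : Tendsto (fun N => IndirectInference.covMatrix P (fun ω => T *ᵥ X N ω)) atTop
      (𝓝 (Gᵀ * W * G)⁻¹) := by
    rw [← IndirectInference.projection_mul_inv_mul_transpose
      (by simpa using hSigPD.isHermitian.eq) hSig_inv hW hHess, ← hT]
    have hc : Continuous fun M : Matrix (Fin m) (Fin m) ℝ => T * M * Tᵀ :=
      (continuous_const.matrix_mul continuous_id).matrix_mul continuous_const
    refine ((hc.tendsto _).comp hSig).congr' ?_
    filter_upwards [hXL] with N hN using (IndirectInference.covMatrix_mulVec hN T).symm
  have hTXC : ∀ᶠ N in atTop, eLpNorm (fun ω => T *ᵥ X N ω) 2 P ≤ (‖Tl‖₊ * C : ℝ≥0) := by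
    filter_upwards [hXC] with N hN
    refine (eLpNorm_le_nnreal_smul_eLpNorm_of_ae_le_mul (c := ‖Tl‖₊)
      (Eventually.of_forall fun ω => Tl.le_opNNNorm (X N ω)) 2).trans ?_
    rw [ENNReal.coe_mul, ENNReal.smul_def, smul_eq_mul]
    gcongr
  simp only [hdecomp]
  refine ⟨?_, IndirectInference.tendsto_covMatrix_add hTXL hRL hTXC hR0 hcovTX⟩
  filter_upwards [hTXL, hRL] with N h1 h2 using h1.add h2
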